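/- **Proposition (Parallel Transport: Projector Perspective).** Let $$\mathrm{Gr}(n,p)=\{P\in\mathbb{R}^{n\times n}\mid P^T=P,\ P^2=P,\ \operatorname{rank}P=p\}$$ be the Grassmann manifold of orthogonal rank-$p$ projectors, an embedded submanifold of $\mathbb{R}^{n\times n}$, with the Riemannian metric $g_P(X,Y)=\tfrac12\operatorname{tr}(X^TY)$ on its tangent spaces $T_P\mathrm{Gr}(n,p)$ (the sets of velocities at $P$ of differentiable curves in $\mathrm{Gr}(n,p)$ through $P$). The covariant derivative of a smooth vector field $V(t)\in T_{\gamma(t)}\mathrm{Gr}(n,p)$ along a smooth curve $\gamma:\mathbb{R}\to\mathrm{Gr}(n,p)$ is the orthogonal projection of the ambient derivative $\frac{\mathrm d}{\mathrm dt}V(t)$ onto $T_{\gamma(t)}\mathrm{Gr}(n,p)$; $V$ is called parallel along $\gamma$ if its covariant derivative vanishes for all $t$, and $\gamma$ is called a geodesic if $\dot\gamma$ is parallel along $\gamma$. The parallel transport of $\Delta\in T_{\gamma(0)}\mathrm{Gr}(n,p)$ along $\gamma$ is the smooth parallel vector field $V$ along $\gamma$ with $V(0)=\Delta$. The Riemannian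 exponential $\mathrm{Exp}^{\mathrm{Gr}}_P(\Gamma)$ is $\gamma(1)$, where $\gamma$ is the geodesic with $\gamma(0)=P$ and $\dot\gamma(0)=\Gamma$. Write $[A,B]=AB-BA$ and $\exp_{\mathrm m}$ for the matrix exponential. Let $P\in\mathrm{Gr}(n,p)$ and $\Delta,\Gamma\in T_P\mathrm{Gr}(n,p)$. Then the unique geodesic $\gamma:\mathbb{R}\to\mathrm{Gr}(n,p)$ with $\gamma(0)=P$ and $\dot\gamma(0)=\Gamma$ is $$\gamma(t)=\mathrm{Exp}^{\mathrm{Gr}}_P(t\Gamma)=\exp_{\mathrm m}(t[\Gamma,P])\,P\,\exp_{\mathrm m}(-t[\Gamma,P]),\qquad t\in\mathbb{R},$$ and the parallel transport of $\Delta$ along $t\mapsto\mathrm{Exp}^{\mathrm{Gr}}_P(t\Gamma)$ exists, is unique, and is given by $$\mathbb{P}_\Delta\big(\mathrm{Exp}^{\mathrm{Gr}}_P(t\Gamma)\big)=\exp_{\mathrm m}(t[\Gamma,P])\,\Delta\,\exp_{\mathrm m}(-t[\Gamma,P]),\qquad t\in\mathbb{R}.$$ -/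

import Mathlib

open scoped ContDiff Matrix.Norms.Operator

/-- The Grassmann manifold of `p`-dimensional subspaces of `ℝⁿ`, identified with the set of
orthogonal projectors of rank `p`. -/
def Gr (n p : ℕ) : Set (Matrix (Fin n) (Fin n) ℝ) :=
  {P | P.transpose = P ∧ P * P = P ∧ P.rank = p}

/-- The tangent space at `P` of the submanifold `Gr n p`: the velocities at time `0` of the
differentiable curves in `Gr n p` that are defined on an interval around `0` and are at `P`
at time `0`. -/
def tangentGr (n p : ℕ) (P : Matrix (Fin n) (Fin n) ℝ) : Set (Matrix (Fin n) (Fin n) ℝ) :=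
  {ξ | ∃ c : ℝ → Matrix (Fin n) (Fin n) ℝ, ∃ ε : ℝ, 0 < ε ∧
    DifferentiableOn ℝ c (Set.Ioo (-ε) ε) ∧ (∀ t ∈ Set.Ioo (-ε) ε, c t ∈ Gr n p) ∧
    c 0 = P ∧ deriv c 0 = ξ}

/-- The Riemannian metric, the restriction to tangent spaces of half the Euclidean
inner product. -/
noncomputable def metricGr {n : ℕ} (X Y : Matrix (Fin n) (Fin n) ℝ) : ℝ :=
  (1 / 2) * (X.transpose * Y).trace

/-- `T` is the orthogonal projection of the ambient matrix `S` onto the tangent space at `P`. -/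
def IsTangentProjection (n p : ℕ) (P S T : Matrix (Fin n) (Fin n) ℝ) : Prop :=
  T ∈ tangentGr n p P ∧ ∀ ξ ∈ tangentGr n p P, metricGr (S - T) ξ = 0

/-- `D` is the covariant derivative at time `t` of the vector field `V` along the curve `γ`
in `Gr n p`: the tangential projection of the ambient derivative of `V`. -/
def IsCovariantDerivAt (n p : ℕ) (γ V : ℝ → Matrix (Fin n) (Fin n) ℝ) (t : ℝ)
    (D : Matrix (Fin n) (Fin n) ℝ) : Prop :=
  IsTangentProjection n p (γ t) (deriv V t) D

/-- `V` is a smooth vector field along the curve `γ` that is parallel, i.e. whose covariant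
derivative vanishes identically. -/
structure IsParallelAlong (n p : ℕ) (γ V : ℝ → Matrix (Fin n) (Fin n) ℝ) : Prop where
  smooth : ContDiff ℝ ∞ V
  tangent : ∀ t, V t ∈ tangentGr n p (γ t)
  parallel : ∀ t, IsCovariantDerivAt n p γ V t 0

/-- `V` is the parallel transport of `Δ` along `γ`, starting at time `0`. -/
structure IsParallelTransport (n p : ℕ) (γ : ℝ → Matrix (Fin n) (Fin n) ℝ)
    (Δ : Matrix (Fin n) (Fin n) ℝ) (V : ℝ → Matrix (Fin n) (Fin n) ℝ) : Prop where
  isParallel : IsParallelAlong n p γ V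
  initial : V 0 = Δ

/-- `γ` is a geodesic of `Gr n p`, defined on the whole real line: a smooth curve whose velocity
field has vanishing covariant derivative. -/
structure IsGeodesicGr (n p : ℕ) (γ : ℝ → Matrix (Fin n) (Fin n) ℝ) : Prop where
  smooth : ContDiff ℝ ∞ γ
  mem : ∀ t, γ t ∈ Gr n p
  geodesic : ∀ t, IsCovariantDerivAt n p γ (deriv γ) t 0

/-- `γ` is the geodesic that emanates from `P` in direction `Γ`. -/
structure IsGeodesicFrom (n p : ℕ) (P Γ : Matrix (Fin n) (Fin n) ℝ)
    (γ : ℝ → Matrix (Fin n) (Fin n) ℝ) : Prop where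
  isGeodesic : IsGeodesicGr n p γ
  initial : γ 0 = P
  velocity : deriv γ 0 = Γ

/-- The Riemannian exponential: the endpoint at time `1` of the geodesic emanating from `P` in
direction `Γ` (an arbitrary value where there is no such geodesic). -/
noncomputable def expGr (n p : ℕ) (P Γ : Matrix (Fin n) (Fin n) ℝ) :
    Matrix (Fin n) (Fin n) ℝ :=
  Classical.epsilon (IsGeodesicFrom n p P Γ) 1

/-! Relative to the splitting by a projector `P`, tangent vectors are the symmetric matrices with
only off-diagonal blocks (`mem_tangentGr_iff`), and a symmetric matrix is normal iff it commutes
with `P` (`isTangentProjection_zero_iff`). So a tangent field `V` is parallel along `γ` iff `V'`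
commutes with `γ`.

For a geodesic, `⁅γ', γ⁆` has derivative `⁅γ'', γ⁆ = 0`, hence stays equal to `Ω = ⁅Γ, P⁆`;
bracketing twice with `γ` fixes `γ'`, so `γ' = ⁅Ω, γ⁆`. For a parallel field, differentiating `γV +
Vγ = V` yields `V' = ⁅⁅γ', γ⁆, V⁆ = ⁅Ω, V⁆`. Both linear equations are solved uniquely by
conjugation with `exp(tΩ)`. Conversely, `⁅Ω, Δ⁆` is block diagonal, and conjugation carries this
from `P` to `γ(t)`. -/

section OffDiagonal

/-! ### Block algebra of an idempotent -/

variable {A : Type*} [Ring A] {P X Y S : A}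

theorem mul_mul_eq_zero_of_offDiagonal (hP : P * P = P) (hX : P * X + X * P = X) :
    P * X * P = 0 := by
  have h := congrArg (P * ·) hX
  simp only [mul_add, ← mul_assoc, hP] at h
  simpa using h

theorem bracket_offDiagonal (hP : P * P = P) (X : A) : P * ⁅X, P⁆ + ⁅X, P⁆ * P = ⁅X, P⁆ := by
  have h1 : P * ⁅X, P⁆ = P * X * P - P * P * X := by rw [Ring.lie_def]; noncomm_ring
  have h2 : ⁅X, P⁆ * P = X * (P * P) - P * X * P := by rw [Ring.lie_def]; noncomm_ring
  rw [h1, h2, hP, Ring.lie_def]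
  abel

/-- Bracketing with `P` fixes one off-diagonal block and negates the other, so doing it twice is the
identity. -/
theorem bracket_bracket_of_offDiagonal (hP : P * P = P) (hX : P * X + X * P = X) :
    ⁅⁅X, P⁆, P⁆ = X := by
  have h1 : ⁅⁅X, P⁆, P⁆ = X * (P * P) - 2 * (P * X * P) + P * P * X := by
    simp only [Ring.lie_def]; noncomm_ring
  rw [h1, hP, mul_mul_eq_zero_of_offDiagonal hP hX, mul_zero, sub_zero, add_comm, hX]

theorem commute_mul_of_offDiagonal (hX : P * X + X * P = X) (hY : P * Y + Y * P = Y) :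
    Commute P (X * Y) := by
  have h1 : P * X = X - X * P := eq_sub_of_add_eq hX
  have h2 : Y * P = Y - P * Y := eq_sub_of_add_eq' hY
  change P * (X * Y) = X * Y * P
  rw [← mul_assoc, h1, mul_assoc X Y P, h2]
  noncomm_ring

theorem commute_bracket_bracket (hP : P * P = P) (X : A) (hY : P * Y + Y * P = Y) :
    Commute P ⁅⁅X, P⁆, Y⁆ := by
  rw [Ring.lie_def]
  exact (commute_mul_of_offDiagonal (bracket_offDiagonal hP X) hY).sub_right
    (commute_mul_of_offDiagonal hY (bracket_offDiagonal hP X))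

/-- `hS` is the derivative of the off-diagonal relation. Since `S` commutes with `P`, it reads `(1 -
2P)S = XY + YX`, which determines `S`. -/
theorem eq_bracket_of_commute (hP : P * P = P) (hX : P * X + X * P = X)
    (hY : P * Y + Y * P = Y) (hc : Commute P S)
    (hS : (X * Y + P * S) + (S * P + Y * X) = S) : S = ⁅⁅X, P⁆, Y⁆ := by
  have hc' : S * P = P * S := hc.eq.symm
  have hYX : Y * X * P = P * (Y * X) := (commute_mul_of_offDiagonal hY hX).eq.symm
  have h1 : X * P = X - P * X := eq_sub_of_add_eq' hX
  have h2 : Y * P = Y - P * Y := eq_sub_of_add_eq' hY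
  have h3 : S - 2 * (P * S) = X * Y + Y * X := by
    rw [hc'] at hS
    nth_rewrite 1 [← hS]
    noncomm_ring
  -- The reflection `1 - 2P` is its own inverse.
  have h4 : S = (S - 2 * (P * S)) - 2 * (P * (S - 2 * (P * S))) := by
    have : (S - 2 * (P * S)) - 2 * (P * (S - 2 * (P * S)))
        = S - 4 * (P * S) + 4 * (P * P * S) := by noncomm_ring
    rw [this, hP]; abel
  have h5 : ⁅⁅X, P⁆, Y⁆ = (X * P) * Y - P * X * Y - Y * X * P + (Y * P) * X := by
    simp only [Ring.lie_def]; noncomm_ring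
  rw [h4, h3, h5, h1, h2, hYX]
  noncomm_ring

end OffDiagonal

/-! ### The linear equation `W' = ⁅Ω, W⁆` -/

section LinearFlow

variable {A : Type*} [NormedRing A] [NormedAlgebra ℝ A] [CompleteSpace A]

theorem NormedSpace.exp_mul_exp_neg_self (x : A) :
    NormedSpace.exp x * NormedSpace.exp (-x) = 1 := by
  let := NormedAlgebra.restrictScalars ℚ ℝ A
  rw [← NormedSpace.exp_add_of_commute (Commute.refl x).neg_right, add_neg_cancel,
    NormedSpace.exp_zero]

theorem NormedSpace.exp_neg_mul_exp_self (x : A) :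
    NormedSpace.exp (-x) * NormedSpace.exp x = 1 := by
  simpa using NormedSpace.exp_mul_exp_neg_self (-x)

theorem hasDerivAt_exp_neg_smul (Ω : A) (t : ℝ) :
    HasDerivAt (fun s : ℝ => NormedSpace.exp (-(s • Ω))) (-(NormedSpace.exp (-(t • Ω)) * Ω)) t := by
  simpa using hasDerivAt_exp_smul_const (𝕂 := ℝ) (-Ω) t

theorem hasDerivAt_exp_conj (Ω X : A) (t : ℝ) :
    HasDerivAt (fun s : ℝ => NormedSpace.exp (s • Ω) * X * NormedSpace.exp (-(s • Ω)))
      (NormedSpace.exp (t • Ω) * ⁅Ω, X⁆ * NormedSpace.exp (-(t • Ω))) t := by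
  have hc : NormedSpace.exp (-(t • Ω)) * Ω = Ω * NormedSpace.exp (-(t • Ω)) :=
    (((Commute.refl Ω).smul_left t).neg_left.exp_left).eq
  have h := (((hasDerivAt_exp_smul_const (𝕂 := ℝ) Ω t).mul_const X).mul
    (hasDerivAt_exp_neg_smul Ω t))
  refine h.congr_deriv ?_
  rw [hc, Ring.lie_def]
  noncomm_ring

theorem contDiff_exp_conj (Ω X : A) :
    ContDiff ℝ ∞ (fun s : ℝ => NormedSpace.exp (s • Ω) * X * NormedSpace.exp (-(s • Ω))) := by
  have h : ContDiff ℝ ∞ (NormedSpace.exp : A → A) :=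
    contDiff_iff_contDiffAt.2 fun x => (NormedSpace.exp_analytic (𝕂 := ℝ) x).contDiffAt
  have hs : ContDiff ℝ ∞ (fun s : ℝ => s • Ω) := contDiff_id.smul contDiff_const
  exact ((h.comp hs).mul contDiff_const).mul (h.comp hs.neg)

/-- Conjugating `W` back by the flow gives a curve with zero derivative. -/
theorem eq_exp_conj_of_deriv_eq_bracket (Ω : A) (W : ℝ → A)
    (hW : ∀ t, HasDerivAt W ⁅Ω, W t⁆ t) (t : ℝ) :
    W t = NormedSpace.exp (t • Ω) * W 0 * NormedSpace.exp (-(t • Ω)) := by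
  have hd : ∀ t, HasDerivAt
      (fun s : ℝ => NormedSpace.exp (-(s • Ω)) * W s * NormedSpace.exp (s • Ω)) 0 t := by
    intro t
    refine (((hasDerivAt_exp_neg_smul Ω t).mul (hW t)).mul
      (hasDerivAt_exp_smul_const' (𝕂 := ℝ) Ω t)).congr_deriv ?_
    simp only [Pi.mul_apply]
    rw [Ring.lie_def]
    noncomm_ring
  have h := is_const_of_deriv_eq_zero (fun t => (hd t).differentiableAt)
    (fun t => (hd t).deriv) t 0
  simp only [zero_smul, neg_zero, NormedSpace.exp_zero, one_mul, mul_one] at h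
  rw [← h]
  simp only [← mul_assoc, NormedSpace.exp_mul_exp_neg_self, one_mul]
  rw [mul_assoc, NormedSpace.exp_mul_exp_neg_self, mul_one]

end LinearFlow

/-! ### Tangent and normal spaces, geodesics and transport -/

section Grassmann

variable {n p : ℕ} {P X Δ Γ : Matrix (Fin n) (Fin n) ℝ}

theorem Matrix.exp_mul_exp_neg_self (X : Matrix (Fin n) (Fin n) ℝ) :
    NormedSpace.exp X * NormedSpace.exp (-X) = 1 :=
  NormedSpace.exp_mul_exp_neg_self X

theorem Matrix.exp_neg_mul_exp_self (X : Matrix (Fin n) (Fin n) ℝ) :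
    NormedSpace.exp (-X) * NormedSpace.exp X = 1 :=
  NormedSpace.exp_neg_mul_exp_self X

theorem Matrix.deriv_exp_conj (Ω X : Matrix (Fin n) (Fin n) ℝ) (t : ℝ) :
    deriv (fun s : ℝ => NormedSpace.exp (s • Ω) * X * NormedSpace.exp (-(s • Ω))) t =
      NormedSpace.exp (t • Ω) * ⁅Ω, X⁆ * NormedSpace.exp (-(t • Ω)) :=
  (hasDerivAt_exp_conj Ω X t).deriv

theorem HasDerivAt.matrix_transpose {c : ℝ → Matrix (Fin n) (Fin n) ℝ}
    {c' : Matrix (Fin n) (Fin n) ℝ} {t : ℝ} (h : HasDerivAt c c' t) :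
    HasDerivAt (fun s => (c s).transpose) c'.transpose t := by
  let L := (Matrix.transposeLinearEquiv (Fin n) (Fin n) ℝ ℝ).toLinearMap.toContinuousLinearMap
  exact L.hasFDerivAt.comp_hasDerivAt t h

theorem exp_transpose_of_skew {Ω : Matrix (Fin n) (Fin n) ℝ} (hΩ : Ω.transpose = -Ω) (t : ℝ) :
    (NormedSpace.exp (t • Ω)).transpose = NormedSpace.exp (-(t • Ω)) := by
  rw [← Matrix.exp_transpose, Matrix.transpose_smul, hΩ, smul_neg]

theorem exp_neg_transpose_of_skew {Ω : Matrix (Fin n) (Fin n) ℝ} (hΩ : Ω.transpose = -Ω) (t : ℝ) :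
    (NormedSpace.exp (-(t • Ω))).transpose = NormedSpace.exp (t • Ω) := by
  rw [← exp_transpose_of_skew hΩ, Matrix.transpose_transpose]

theorem exp_conj_mul_exp_conj (Ω X Y : Matrix (Fin n) (Fin n) ℝ) (t : ℝ) :
    (NormedSpace.exp (t • Ω) * X * NormedSpace.exp (-(t • Ω))) *
      (NormedSpace.exp (t • Ω) * Y * NormedSpace.exp (-(t • Ω))) =
      NormedSpace.exp (t • Ω) * (X * Y) * NormedSpace.exp (-(t • Ω)) := by
  have h := Matrix.exp_neg_mul_exp_self (t • Ω)
  calc _ = NormedSpace.exp (t • Ω) * X * (NormedSpace.exp (-(t • Ω)) * NormedSpace.exp (t • Ω))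
        * Y * NormedSpace.exp (-(t • Ω)) := by simp only [mul_assoc]
    _ = _ := by rw [h, mul_one]; simp only [mul_assoc]

theorem transpose_exp_conj {Ω X : Matrix (Fin n) (Fin n) ℝ} (hΩ : Ω.transpose = -Ω)
    (hX : X.transpose = X) (t : ℝ) :
    (NormedSpace.exp (t • Ω) * X * NormedSpace.exp (-(t • Ω))).transpose =
      NormedSpace.exp (t • Ω) * X * NormedSpace.exp (-(t • Ω)) := by
  rw [Matrix.transpose_mul, Matrix.transpose_mul, exp_transpose_of_skew hΩ,
    exp_neg_transpose_of_skew hΩ, hX, mul_assoc]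

theorem exp_conj_mem_Gr {Ω : Matrix (Fin n) (Fin n) ℝ} (hΩ : Ω.transpose = -Ω)
    (hP : P ∈ Gr n p) (t : ℝ) :
    NormedSpace.exp (t • Ω) * P * NormedSpace.exp (-(t • Ω)) ∈ Gr n p := by
  refine ⟨transpose_exp_conj hΩ hP.1 t, ?_, ?_⟩
  · rw [exp_conj_mul_exp_conj, hP.2.1]
  · have h1 := Matrix.exp_mul_exp_neg_self (t • Ω)
    have h2 := Matrix.exp_neg_mul_exp_self (t • Ω)
    rw [Matrix.rank_mul_eq_left_of_isUnit_det _ _ (Matrix.isUnit_det_of_left_inverse h1),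
      Matrix.rank_mul_eq_right_of_isUnit_det _ _ (Matrix.isUnit_det_of_left_inverse h2), hP.2.2]

theorem transpose_bracket_of_symm (hP : P.transpose = P) (hX : X.transpose = X) :
    (⁅X, P⁆).transpose = -⁅X, P⁆ := by
  rw [Ring.lie_def, Matrix.transpose_sub, Matrix.transpose_mul, Matrix.transpose_mul, hP, hX,
    neg_sub]

theorem symm_and_offDiagonal_of_hasDerivAt {c : ℝ → Matrix (Fin n) (Fin n) ℝ}
    {t : ℝ} (hc : HasDerivAt c X t) (hmem : ∀ᶠ s in nhds t, c s ∈ Gr n p) :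
    X.transpose = X ∧ c t * X + X * c t = X := by
  constructor
  · exact hc.matrix_transpose.unique (hc.congr_of_eventuallyEq (hmem.mono fun s hs => hs.1))
  · rw [add_comm]
    exact (hc.mul hc).unique (hc.congr_of_eventuallyEq (hmem.mono fun s hs => hs.2.1))

theorem mem_tangentGr_iff (hP : P ∈ Gr n p) :
    X ∈ tangentGr n p P ↔ X.transpose = X ∧ P * X + X * P = X := by
  constructor
  · rintro ⟨c, ε, hε, hd, hmem, rfl, rfl⟩
    have hnhds : Set.Ioo (-ε) ε ∈ nhds (0 : ℝ) := Ioo_mem_nhds (by linarith) hε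
    exact symm_and_offDiagonal_of_hasDerivAt (hd.differentiableAt hnhds).hasDerivAt
      (Filter.mem_of_superset hnhds hmem)
  · rintro ⟨hs, ho⟩
    -- The velocity of this curve at 0 is `⁅⁅X, P⁆, P⁆ = X`.
    refine ⟨fun t => NormedSpace.exp (t • ⁅X, P⁆) * P * NormedSpace.exp (-(t • ⁅X, P⁆)), 1,
      one_pos, fun t _ => (hasDerivAt_exp_conj _ _ t).differentiableAt.differentiableWithinAt,
      fun t _ => exp_conj_mem_Gr (transpose_bracket_of_symm hP.1 hs) hP t, ?_, ?_⟩
    · simp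
    · rw [Matrix.deriv_exp_conj, bracket_bracket_of_offDiagonal hP.2.1 ho]
      simp

theorem isTangentProjection_zero_iff {S : Matrix (Fin n) (Fin n) ℝ} (hP : P ∈ Gr n p)
    (hS : S.transpose = S) : IsTangentProjection n p P S 0 ↔ Commute P S := by
  have h0 : (0 : Matrix (Fin n) (Fin n) ℝ) ∈ tangentGr n p P := (mem_tangentGr_iff hP).2 (by simp)
  constructor
  · rintro ⟨-, h⟩
    have hA := transpose_bracket_of_symm hP.1 hS
    have hAP : (⁅⁅S, P⁆, P⁆).transpose = ⁅⁅S, P⁆, P⁆ := by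
      rw [Ring.lie_def ⁅S, P⁆, Matrix.transpose_sub, Matrix.transpose_mul, Matrix.transpose_mul,
        hP.1, hA]
      noncomm_ring
    -- Pairing `S` with this tangent vector gives half the squared Frobenius norm of `⁅S, P⁆`.
    have h1 := h ⁅⁅S, P⁆, P⁆ ((mem_tangentGr_iff hP).2 ⟨hAP, bracket_offDiagonal hP.2.1 _⟩)
    rw [metricGr, sub_zero, hS] at h1
    have h2 : (S * ⁅⁅S, P⁆, P⁆).trace = ((⁅S, P⁆).transpose * ⁅S, P⁆).trace := by
      rw [hA]
      have e1 : S * ⁅⁅S, P⁆, P⁆ = (S * ⁅S, P⁆) * P - S * P * ⁅S, P⁆ := by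
        rw [Ring.lie_def ⁅S, P⁆]; noncomm_ring
      have e2 : -⁅S, P⁆ * ⁅S, P⁆ = P * (S * ⁅S, P⁆) - S * P * ⁅S, P⁆ := by
        nth_rewrite 1 [Ring.lie_def]; noncomm_ring
      rw [e1, e2, Matrix.trace_sub, Matrix.trace_sub, Matrix.trace_mul_comm (S * ⁅S, P⁆) P]
    have h3 : ((⁅S, P⁆).conjTranspose * ⁅S, P⁆).trace = 0 := by
      rw [Matrix.conjTranspose_eq_transpose_of_trivial, ← h2]; linarith
    have h4 : ⁅S, P⁆ = 0 := Matrix.trace_conjTranspose_mul_self_eq_zero_iff.1 h3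
    rw [Ring.lie_def, sub_eq_zero] at h4
    exact h4.symm
  · intro hc
    refine ⟨h0, fun X hX => ?_⟩
    have ho := ((mem_tangentGr_iff hP).1 hX).2
    have hz := mul_mul_eq_zero_of_offDiagonal hP.2.1 ho
    have hPX : (S * (P * X)).trace = 0 := by
      have : S * (P * X) = P * (S * P * X) := by
        rw [← hc.eq, ← mul_assoc, ← mul_assoc, ← mul_assoc, hP.2.1, hc.eq]
      rw [this, Matrix.trace_mul_comm, mul_assoc S, mul_assoc S, hz, mul_zero, Matrix.trace_zero]
    have hXP : (S * (X * P)).trace = 0 := by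
      rw [← mul_assoc, Matrix.trace_mul_comm, ← mul_assoc, hc.eq, mul_assoc, hPX]
    rw [metricGr, sub_zero, hS, ← ho, mul_add, Matrix.trace_add, hPX, hXP]
    simp

theorem isParallelAlong_exp_conj {Ω : Matrix (Fin n) (Fin n) ℝ} (hΩ : Ω.transpose = -Ω)
    (hP : P ∈ Gr n p) (hΔ : Δ ∈ tangentGr n p P) (hc : Commute P ⁅Ω, Δ⁆) :
    IsParallelAlong n p
      (fun t => NormedSpace.exp (t • Ω) * P * NormedSpace.exp (-(t • Ω)))
      (fun t => NormedSpace.exp (t • Ω) * Δ * NormedSpace.exp (-(t • Ω))) := by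
  obtain ⟨hs, ho⟩ := (mem_tangentGr_iff hP).1 hΔ
  refine ⟨contDiff_exp_conj _ _, fun t => ?_, fun t => ?_⟩
  · refine (mem_tangentGr_iff (exp_conj_mem_Gr hΩ hP t)).2 ⟨transpose_exp_conj hΩ hs t, ?_⟩
    rw [exp_conj_mul_exp_conj, exp_conj_mul_exp_conj, ← add_mul, ← mul_add, ho]
  · have hb : (⁅Ω, Δ⁆).transpose = ⁅Ω, Δ⁆ := by
      rw [Ring.lie_def, Matrix.transpose_sub, Matrix.transpose_mul, Matrix.transpose_mul, hs, hΩ]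
      noncomm_ring
    rw [IsCovariantDerivAt, Matrix.deriv_exp_conj,
      isTangentProjection_zero_iff (exp_conj_mem_Gr hΩ hP t) (transpose_exp_conj hΩ hb t)]
    change _ * _ = _ * _
    rw [exp_conj_mul_exp_conj, exp_conj_mul_exp_conj, hc.eq]

theorem isGeodesicFrom_iff (hP : P ∈ Gr n p) (hΓ : Γ ∈ tangentGr n p P)
    (γ : ℝ → Matrix (Fin n) (Fin n) ℝ) :
    IsGeodesicFrom n p P Γ γ ↔
      γ = fun t => NormedSpace.exp (t • ⁅Γ, P⁆) * P * NormedSpace.exp (-(t • ⁅Γ, P⁆)) := by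
  obtain ⟨hs, ho⟩ := (mem_tangentGr_iff hP).1 hΓ
  constructor
  · rintro ⟨⟨hsm, hmem, hgeo⟩, h0, hv⟩
    have hd : ∀ t, HasDerivAt γ (deriv γ t) t := fun t =>
      (hsm.differentiable (by simp) t).hasDerivAt
    have hsm' : ContDiff ℝ ∞ (deriv γ) := (contDiff_infty_iff_deriv.1 hsm).2
    have hd' : ∀ t, HasDerivAt (deriv γ) (deriv (deriv γ) t) t := fun t =>
      (hsm'.differentiable (by simp) t).hasDerivAt
    have htan := fun t => symm_and_offDiagonal_of_hasDerivAt (hd t)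
      (Filter.Eventually.of_forall hmem)
    have hcomm : ∀ t, Commute (γ t) (deriv (deriv γ) t) := by
      intro t
      refine (isTangentProjection_zero_iff (hmem t) ?_).1 (hgeo t)
      exact (hd' t).matrix_transpose.unique
        ((hd' t).congr_of_eventuallyEq (Filter.Eventually.of_forall fun s => (htan s).1))
    have hΩ : ∀ t, HasDerivAt (fun s => ⁅deriv γ s, γ s⁆) 0 t := by
      intro t
      refine (((hd' t).mul (hd t)).sub ((hd t).mul (hd' t))).congr_deriv ?_
      rw [← (hcomm t).eq]
      abel
    have hconst : ∀ t, ⁅deriv γ t, γ t⁆ = ⁅Γ, P⁆ := by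
      intro t
      rw [is_const_of_deriv_eq_zero (fun t => (hΩ t).differentiableAt)
        (fun t => (hΩ t).deriv) t 0, h0, hv]
    funext t
    refine (eq_exp_conj_of_deriv_eq_bracket ⁅Γ, P⁆ γ (fun t => ?_) t).trans (by rw [h0]; rfl)
    rw [← hconst t, bracket_bracket_of_offDiagonal (hmem t).2.1 (htan t).2]
    exact hd t
  · rintro rfl
    have hΩ := transpose_bracket_of_symm hP.1 hs
    have hder : deriv (fun t : ℝ =>
        NormedSpace.exp (t • ⁅Γ, P⁆) * P * NormedSpace.exp (-(t • ⁅Γ, P⁆))) =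
        fun t => NormedSpace.exp (t • ⁅Γ, P⁆) * Γ * NormedSpace.exp (-(t • ⁅Γ, P⁆)) := by
      funext t
      rw [Matrix.deriv_exp_conj, bracket_bracket_of_offDiagonal hP.2.1 ho]
    refine ⟨⟨contDiff_exp_conj _ _, exp_conj_mem_Gr hΩ hP, ?_⟩, by simp, ?_⟩
    · rw [hder]
      exact (isParallelAlong_exp_conj hΩ hP hΓ (commute_bracket_bracket hP.2.1 Γ ho)).parallel
    · rw [hder]
      simp

/-- Existence and uniqueness of the geodesic pin down the arbitrary choice in `expGr`. -/
theorem expGr_eq (hP : P ∈ Gr n p) (hΓ : Γ ∈ tangentGr n p P) :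
    expGr n p P Γ = NormedSpace.exp ⁅Γ, P⁆ * P * NormedSpace.exp (-⁅Γ, P⁆) := by
  have h := Classical.epsilon_spec (p := IsGeodesicFrom n p P Γ)
    ⟨_, (isGeodesicFrom_iff hP hΓ _).2 rfl⟩
  rw [expGr, (isGeodesicFrom_iff hP hΓ _).1 h]
  simp only [one_smul]

theorem smul_mem_tangentGr (hP : P ∈ Gr n p) (hΓ : Γ ∈ tangentGr n p P) (t : ℝ) :
    t • Γ ∈ tangentGr n p P := by
  obtain ⟨hs, ho⟩ := (mem_tangentGr_iff hP).1 hΓ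
  refine (mem_tangentGr_iff hP).2 ⟨by rw [Matrix.transpose_smul, hs], ?_⟩
  rw [mul_smul_comm, smul_mul_assoc, ← smul_add, ho]

theorem expGr_smul_eq (hP : P ∈ Gr n p) (hΓ : Γ ∈ tangentGr n p P) (t : ℝ) :
    expGr n p P (t • Γ) =
      NormedSpace.exp (t • ⁅Γ, P⁆) * P * NormedSpace.exp (-(t • ⁅Γ, P⁆)) := by
  have hb : ⁅t • Γ, P⁆ = t • ⁅Γ, P⁆ := by
    rw [Ring.lie_def, Ring.lie_def, smul_mul_assoc, mul_smul_comm, smul_sub]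
  rw [expGr_eq hP (smul_mem_tangentGr hP hΓ t), hb]

/-- Along any curve of projectors, parallel fields solve a linear differential equation. -/
theorem IsParallelAlong.hasDerivAt {γ V : ℝ → Matrix (Fin n) (Fin n) ℝ}
    (hV : IsParallelAlong n p γ V) (hmem : ∀ t, γ t ∈ Gr n p) {t : ℝ} (hγ : HasDerivAt γ X t) :
    HasDerivAt V ⁅⁅X, γ t⁆, V t⁆ t := by
  have hd : HasDerivAt V (deriv V t) t := (hV.smooth.differentiable (by simp) t).hasDerivAt
  have htan := fun s => (mem_tangentGr_iff (hmem s)).1 (hV.tangent s)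
  have hsymm : (deriv V t).transpose = deriv V t := hd.matrix_transpose.unique
    (hd.congr_of_eventuallyEq (Filter.Eventually.of_forall fun s => (htan s).1))
  have hcomm := (isTangentProjection_zero_iff (hmem t) hsymm).1 (hV.parallel t)
  have hX := (symm_and_offDiagonal_of_hasDerivAt hγ (Filter.Eventually.of_forall hmem)).2
  have hleib : (X * V t + γ t * deriv V t) + (deriv V t * γ t + V t * X) = deriv V t :=
    ((hγ.mul hd).add (hd.mul hγ)).unique
      (hd.congr_of_eventuallyEq (Filter.Eventually.of_forall fun s => (htan s).2))
  rw [← eq_bracket_of_commute (hmem t).2.1 hX (htan t).2 hcomm hleib]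
  exact hd

/-- With `X = Γ`, `Y = P`: `⁅γ', γ⁆` remains `Ω` along the geodesic, as `Ω` commutes with its own
exponential. -/
theorem bracket_exp_conj (X Y : Matrix (Fin n) (Fin n) ℝ) (t : ℝ) :
    ⁅NormedSpace.exp (t • ⁅X, Y⁆) * X * NormedSpace.exp (-(t • ⁅X, Y⁆)),
      NormedSpace.exp (t • ⁅X, Y⁆) * Y * NormedSpace.exp (-(t • ⁅X, Y⁆))⁆ = ⁅X, Y⁆ := by
  have hc : NormedSpace.exp (t • ⁅X, Y⁆) * ⁅X, Y⁆ = ⁅X, Y⁆ * NormedSpace.exp (t • ⁅X, Y⁆) :=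
    (((Commute.refl ⁅X, Y⁆).smul_left t).exp_left).eq
  -- Keeps the bracket in the exponents from being unfolded.
  generalize hΩ : ⁅X, Y⁆ = Ω at *
  rw [Ring.lie_def, exp_conj_mul_exp_conj, exp_conj_mul_exp_conj, ← sub_mul, ← mul_sub,
    ← Ring.lie_def, hΩ, hc, mul_assoc, Matrix.exp_mul_exp_neg_self, mul_one]

theorem isParallelTransport_iff (hP : P ∈ Gr n p) (hΔ : Δ ∈ tangentGr n p P)
    (hΓ : Γ ∈ tangentGr n p P) (V : ℝ → Matrix (Fin n) (Fin n) ℝ) :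
    IsParallelTransport n p
      (fun t => NormedSpace.exp (t • ⁅Γ, P⁆) * P * NormedSpace.exp (-(t • ⁅Γ, P⁆))) Δ V ↔
      V = fun t => NormedSpace.exp (t • ⁅Γ, P⁆) * Δ * NormedSpace.exp (-(t • ⁅Γ, P⁆)) := by
  obtain ⟨hs, ho⟩ := (mem_tangentGr_iff hP).1 hΓ
  have hΩ := transpose_bracket_of_symm hP.1 hs
  constructor
  · rintro ⟨hV, h0⟩
    funext t
    refine (eq_exp_conj_of_deriv_eq_bracket ⁅Γ, P⁆ V (fun t => ?_) t).trans (by rw [h0]; rfl)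
    have hγ : HasDerivAt
        (fun s : ℝ => NormedSpace.exp (s • ⁅Γ, P⁆) * P * NormedSpace.exp (-(s • ⁅Γ, P⁆)))
        (NormedSpace.exp (t • ⁅Γ, P⁆) * Γ * NormedSpace.exp (-(t • ⁅Γ, P⁆))) t :=
      (hasDerivAt_exp_conj ⁅Γ, P⁆ P t).congr_deriv
        (by rw [bracket_bracket_of_offDiagonal hP.2.1 ho]; rfl)
    exact (hV.hasDerivAt (exp_conj_mem_Gr hΩ hP) hγ).congr_deriv
      (congrArg (⁅·, V t⁆) (bracket_exp_conj Γ P t))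
  · rintro rfl
    exact ⟨isParallelAlong_exp_conj hΩ hP hΔ
      (commute_bracket_bracket hP.2.1 Γ ((mem_tangentGr_iff hP).1 hΔ).2), by simp⟩

end Grassmann

theorem mainTheorem4 (n p : ℕ) (P Δ Γ : Matrix (Fin n) (Fin n) ℝ) (hP : P ∈ Gr n p)
    (hΔ : Δ ∈ tangentGr n p P) (hΓ : Γ ∈ tangentGr n p P) :
    (∀ γ : ℝ → Matrix (Fin n) (Fin n) ℝ, IsGeodesicFrom n p P Γ γ ↔
      γ = fun t => NormedSpace.exp (t • ⁅Γ, P⁆) * P * NormedSpace.exp (-(t • ⁅Γ, P⁆))) ∧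
    (∀ t : ℝ, expGr n p P (t • Γ) =
      NormedSpace.exp (t • ⁅Γ, P⁆) * P * NormedSpace.exp (-(t • ⁅Γ, P⁆))) ∧
    (∀ V : ℝ → Matrix (Fin n) (Fin n) ℝ,
      IsParallelTransport n p (fun t => expGr n p P (t • Γ)) Δ V ↔
        V = fun t =>
          NormedSpace.exp (t • ⁅Γ, P⁆) * Δ * NormedSpace.exp (-(t • ⁅Γ, P⁆))) := by
  refine ⟨isGeodesicFrom_iff hP hΓ, expGr_smul_eq hP hΓ, fun V => ?_⟩
  rw [funext (expGr_smul_eq hP hΓ)]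
  exact isParallelTransport_iff hP hΔ hΓ V
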